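/- Let $n\ge 5$ be an integer, $p>1$, $-n<\alpha\le -2$, $\mu\ge 0$ and $\lambda>(n-2)(2+\alpha)+2\sqrt{\mu}$. Put $$K_2=\frac{(n-2)^2+(\alpha+2)^2}{2}-\lambda,\qquad K_0=\frac{(n-4-\alpha)^2(n+\alpha)^2}{16}-\lambda\Big(\frac{n-4-\alpha}{2}\Big)^2+\mu,$$ and assume $K_2>0$ and $K_0>0$. Let $v\in H^2(\mathbb{R})\cap C^4(\mathbb{R})$ be a positive even solution of $$v^{(4)}-K_2v''+K_0v=v^p\quad\text{on }\mathbb{R}$$ (for example the even positive ground state, i.e. the minimizer of $\int_{\mathbb R}(|w''|^2+K_2|w'|^2+K_0w^2)\,dt\,\big/\,\big(\int_{\mathbb R}|w|^{p+1}dt\big)^{2/(p+1)}$ over $w\in H^2(\mathbb{R})\setminus\{0\}$, normalized so as to solve the equation), and define $$u(x)=|x|^{-\frac{n-4-\alpha}{2}}\,v(-\ln|x|),\qquad x\in\mathbb{R}^n\setminus\{0\}.$$ Then $u(x)\to+\infty$ as $x\to 0$. In particular the singularity of $u$ at the origin is non-removable: $u$ is not bounded near $0$ and has no continuous extension to $0$.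 Moreover, $v$ is not periodic. -/

import Mathlib

open MeasureTheory Filter Topology

namespace WeightedBiharmonic

/-- The coefficient `K₂` of the Emden-Fowler equation `v⁗ - K₂ v'' + K₀ v = v ^ p`. -/
noncomputable def K₂ (n : ℕ) (α lam : ℝ) : ℝ :=
  (((n : ℝ) - 2) ^ 2 + (α + 2) ^ 2) / 2 - lam

/-- The coefficient `K₀` of the Emden-Fowler equation `v⁗ - K₂ v'' + K₀ v = v ^ p`. -/
noncomputable def K₀ (n : ℕ) (α lam mu : ℝ) : ℝ :=
  ((n : ℝ) - 4 - α) ^ 2 * ((n : ℝ) + α) ^ 2 / 16 - lam * (((n : ℝ) - 4 - α) / 2) ^ 2 + mu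

/-- `w` is a positive even solution in `H²(ℝ)` of `w⁗ - A w'' + B w = |w| ^ (q - 1) w` on `ℝ`.
Membership in `H²(ℝ)` is expressed through the classical derivatives, which are the weak ones since
`w` is `C⁴`; the absolute value on the right is not needed since `w` is positive.
The even positive ground state of the equation is such a function. -/
structure IsPositiveEvenH2Solution (A B q : ℝ) (w : ℝ → ℝ) : Prop where
  contDiff : ContDiff ℝ 4 w
  ode : ∀ t, iteratedDeriv 4 w t - A * iteratedDeriv 2 w t + B * w t = w t ^ q
  memLp_self : MemLp w 2 volume
  memLp_deriv : MemLp (deriv w) 2 volume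
  memLp_deriv_two : MemLp (iteratedDeriv 2 w) 2 volume
  even : ∀ t, w (-t) = w t
  pos : ∀ t, 0 < w t

/-- The radial function `u(x) = |x| ^ (-(n - 4 - α) / 2) v(-ln |x|)` on `ℝⁿ \ {0}`
(its value at the origin plays no role). -/
noncomputable def radialProfile (n : ℕ) (α : ℝ) (v : ℝ → ℝ) (x : EuclideanSpace ℝ (Fin n)) : ℝ :=
  ‖x‖ ^ (-(((n : ℝ) - 4 - α) / 2)) * v (-Real.log ‖x‖)

/-- `u` is `O(1)` near the origin, the origin excluded. -/
def BoundedNearZero {n : ℕ} (u : EuclideanSpace ℝ (Fin n) → ℝ) : Prop :=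
  ∃ C : ℝ, ∀ᶠ x in 𝓝[≠] (0 : EuclideanSpace ℝ (Fin n)), |u x| ≤ C

/-- `u`, restricted to the complement of the origin, extends continuously to the origin. -/
def ExtendsContinuouslyToZero {n : ℕ} (u : EuclideanSpace ℝ (Fin n) → ℝ) : Prop :=
  ∃ w : EuclideanSpace ℝ (Fin n) → ℝ, ContinuousAt w 0 ∧ ∀ x, x ≠ 0 → w x = u x

end WeightedBiharmonic

namespace WeightedBiharmonic

/-! The equation factors as `(∂² - b²)(∂² - a²) v = v ^ p > 0`, with `a² ≤ b²` the roots of `X² - K₂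
X + K₀`. Hence `f = a² v - v''` satisfies `f'' < b² f`, and square integrability, in place of
boundary conditions, yields a maximum principle: `f > 0`. Then `v'' < a² v`, which makes `exp (a t)
v` nondecreasing, so `v t ≥ v 0 * exp (-a t)` for `t ≥ 0`. The bound on `lam` forces `a < γ = (n - 4
- α) / 2`; with `t = -ln |x|`, `u = exp (γ t) v t ≥ v 0 * exp ((γ - a) t)` blows up. -/

/-- A square integrable function on `ℝ` does not stay away from zero near `+∞`. -/
theorem not_memLp_two_of_eventually_le_abs {f : ℝ → ℝ} {c : ℝ} (hc : 0 < c)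
    (h : ∀ᶠ t in atTop, c ≤ |f t|) : ¬ MemLp f 2 volume := by
  intro hf
  obtain ⟨T, hT⟩ := eventually_atTop.1 h
  have hconst : MemLp (fun _ : ℝ => c) 2 (volume.restrict (Set.Ici T)) := by
    refine (hf.restrict (Set.Ici T)).mono aestronglyMeasurable_const ?_
    filter_upwards [ae_restrict_mem measurableSet_Ici] with t ht
    simpa [Real.norm_eq_abs, abs_of_pos hc] using hT t ht
  rw [memLp_const_iff (by norm_num) (by norm_num)] at hconst
  rcases hconst with h0 | hfin
  · exact hc.ne' h0
  · simp at hfin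

/-- A square integrable strict supersolution of `f'' = s² f` satisfies `f' + s f > 0`. -/
theorem deriv_add_mul_pos_of_memLp {f f' f'' : ℝ → ℝ} {s : ℝ} (hs : 0 < s)
    (hf : ∀ t, HasDerivAt f (f' t) t) (hf' : ∀ t, HasDerivAt f' (f'' t) t)
    (hlt : ∀ t, f'' t < s ^ 2 * f t) (hL : MemLp f 2 volume) (t : ℝ) :
    0 < f' t + s * f t := by
  by_contra! hle
  have hexp : ∀ k x : ℝ, HasDerivAt (fun y => Real.exp (k * y)) (Real.exp (k * x) * k) x :=
    fun k x => by simpa using ((hasDerivAt_id x).const_mul k).exp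
  -- Since `f'' - s² f = (∂ - s)(f' + s f)`, the derivative here is `exp (-s x) (f'' - s² f) < 0`.
  have hanti : StrictAnti fun x => Real.exp (-s * x) * (f' x + s * f x) := by
    refine strictAnti_of_hasDerivAt_neg (f' := fun x => Real.exp (-s * x) * -s * (f' x + s * f x)
      + Real.exp (-s * x) * (f'' x + s * f' x))
      (fun x => (hexp (-s) x).mul ((hf' x).add ((hf x).const_mul s))) fun x => ?_
    have h1 : 0 < Real.exp (-s * x) * (s ^ 2 * f x - f'' x) :=
      mul_pos (Real.exp_pos _) (sub_pos.2 (hlt x))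
    linarith
  -- Moving from `t` to `t + 1` turns the value `≤ 0` into a strictly negative one, `-c`.
  obtain ⟨c, hc, hg⟩ : ∃ c > 0, ∀ x ≥ t + 1, f' x + s * f x ≤ -c * Real.exp (s * x) := by
    refine ⟨-(Real.exp (-s * (t + 1)) * (f' (t + 1) + s * f (t + 1))), ?_, fun x hx => ?_⟩
    · have h1 := hanti (lt_add_one t)
      have h2 := mul_nonpos_of_nonneg_of_nonpos (Real.exp_pos (-s * t)).le hle
      simp only at h1
      linarith
    · have h1 := mul_le_mul_of_nonneg_right (hanti.antitone hx) (Real.exp_pos (s * x)).le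
      have h2 : Real.exp (-s * x) * Real.exp (s * x) = 1 := by
        rw [← Real.exp_add]; simp
      calc f' x + s * f x
          = Real.exp (-s * x) * (f' x + s * f x) * Real.exp (s * x) := by
            linear_combination -(f' x + s * f x) * h2
        _ ≤ _ := by simpa using h1
  -- Integrates `(exp (s x) f)' = exp (s x) (f' + s f) ≤ -c exp (2 s x)`.
  have hφ : AntitoneOn (fun x => Real.exp (s * x) * f x + c / (2 * s) * Real.exp (2 * s * x))
      (Set.Ici (t + 1)) := by
    have hd : ∀ x, HasDerivAt
        (fun x => Real.exp (s * x) * f x + c / (2 * s) * Real.exp (2 * s * x))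
        (Real.exp (s * x) * s * f x + Real.exp (s * x) * f' x
          + c / (2 * s) * (Real.exp (2 * s * x) * (2 * s))) x :=
      fun x => ((hexp s x).mul (hf x)).add ((hexp (2 * s) x).const_mul _)
    refine antitoneOn_of_deriv_nonpos (convex_Ici _)
      (fun x _ => (hd x).continuousAt.continuousWithinAt)
      (fun x _ => (hd x).differentiableAt.differentiableWithinAt) fun x hx => ?_
    rw [interior_Ici] at hx
    rw [(hd x).deriv]
    have h1 := mul_le_mul_of_nonneg_left (hg x (le_of_lt hx)) (Real.exp_pos (s * x)).le
    have h2 : Real.exp (2 * s * x) = Real.exp (s * x) * Real.exp (s * x) := by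
      rw [← Real.exp_add]; ring_nf
    have h3 : c / (2 * s) * (Real.exp (2 * s * x) * (2 * s))
        = c * (Real.exp (s * x) * Real.exp (s * x)) := by
      rw [h2]; field_simp
    rw [h3]
    linarith
  set M := Real.exp (s * (t + 1)) * f (t + 1) + c / (2 * s) * Real.exp (2 * s * (t + 1))
  have hlim : Tendsto (fun x : ℝ => c / (2 * s) * Real.exp (s * x)) atTop atTop :=
    (Real.tendsto_exp_atTop.comp (tendsto_id.const_mul_atTop hs)).const_mul_atTop (by positivity)
  refine not_memLp_two_of_eventually_le_abs (f := f) one_pos ?_ hL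
  -- The threshold `|M| + 1` gives `exp (s x) f x ≤ M - (|M| + 1) exp (s x) ≤ -exp (s x)`, hence `f
  -- x ≤ -1` eventually.
  filter_upwards [hlim.eventually_ge_atTop (|M| + 1), eventually_ge_atTop (t + 1),
    eventually_ge_atTop 0] with x hx hxt hx0
  have h1 : Real.exp (s * x) * f x + c / (2 * s) * Real.exp (2 * s * x) ≤ M :=
    hφ Set.self_mem_Ici hxt hxt
  have h2 : Real.exp (2 * s * x) = Real.exp (s * x) * Real.exp (s * x) := by
    rw [← Real.exp_add]; ring_nf
  have h3 : 1 ≤ Real.exp (s * x) := Real.one_le_exp (by positivity)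
  have h4 : Real.exp (s * x) * (f x + 1) ≤ 0 := by
    have h5 := mul_le_mul_of_nonneg_left hx (Real.exp_pos (s * x)).le
    have h6 := mul_le_mul_of_nonneg_right h3 (abs_nonneg M)
    rw [h2] at h1
    linarith [le_abs_self M]
  have h5 : f x + 1 ≤ 0 := nonpos_of_mul_nonpos_right h4 (Real.exp_pos _)
  exact le_trans (by linarith) (neg_le_abs (f x))

/-- A square integrable strict supersolution of `f'' = s² f` decays no faster than `exp (-s t)`. -/
theorem mul_exp_neg_le_of_memLp {f f' f'' : ℝ → ℝ} {s : ℝ} (hs : 0 < s)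
    (hf : ∀ t, HasDerivAt f (f' t) t) (hf' : ∀ t, HasDerivAt f' (f'' t) t)
    (hlt : ∀ t, f'' t < s ^ 2 * f t) (hL : MemLp f 2 volume) {t : ℝ} (ht : 0 ≤ t) :
    f 0 * Real.exp (-(s * t)) ≤ f t := by
  have hmono : Monotone fun x => Real.exp (s * x) * f x := by
    refine monotone_of_hasDerivAt_nonneg
      (f' := fun x => Real.exp (s * x) * s * f x + Real.exp (s * x) * f' x) (fun x => ?_)
      fun x => ?_
    · exact HasDerivAt.mul (by simpa using ((hasDerivAt_id x).const_mul s).exp) (hf x)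
    · have := mul_pos (Real.exp_pos (s * x)) (deriv_add_mul_pos_of_memLp hs hf hf' hlt hL x)
      simp only [Pi.zero_apply]
      linarith
  have h := hmono ht
  simp only [mul_zero, Real.exp_zero, one_mul] at h
  rw [Real.exp_neg, ← div_eq_mul_inv, div_le_iff₀ (Real.exp_pos _)]
  linarith

/-- A square integrable strict supersolution of `f'' = s² f` is positive. -/
theorem pos_of_memLp {f f' f'' : ℝ → ℝ} {s : ℝ} (hs : 0 < s)
    (hf : ∀ t, HasDerivAt f (f' t) t) (hf' : ∀ t, HasDerivAt f' (f'' t) t)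
    (hlt : ∀ t, f'' t < s ^ 2 * f t) (hL : MemLp f 2 volume) (t : ℝ) : 0 < f t := by
  have h1 := deriv_add_mul_pos_of_memLp hs hf hf' hlt hL t
  have hL' : MemLp (fun x => f (-x)) 2 volume :=
    hL.comp_measurePreserving (Measure.measurePreserving_neg volume)
  -- The hypotheses are invariant under `x ↦ -x`, so also `s f - f' > 0`; adding the two
  -- inequalities removes `f'`.
  have h2 := deriv_add_mul_pos_of_memLp (f := fun x => f (-x)) (f' := fun x => -f' (-x))
    (f'' := fun x => f'' (-x)) hs
    (fun x => by simpa [Function.comp_def] using (hf (-x)).comp x (hasDerivAt_neg x))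
    (fun x => ((hf' (-x)).comp x (hasDerivAt_neg x)).neg.congr_deriv (by ring))
    (fun x => hlt (-x)) hL' (-t)
  simp only [neg_neg] at h2
  exact pos_of_mul_pos_right (a := s) (by linarith) hs.le

/-- If the characteristic polynomial factors as `(X² - a²)(X² - b²)`, then a positive `H²` solution
decays no faster than `exp (-a t)`. -/
theorem IsPositiveEvenH2Solution.mul_exp_neg_le {a b q : ℝ} {w : ℝ → ℝ} (ha : 0 < a) (hb : 0 < b)
    (hw : IsPositiveEvenH2Solution (a ^ 2 + b ^ 2) (a ^ 2 * b ^ 2) q w) {t : ℝ} (ht : 0 ≤ t) :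
    w 0 * Real.exp (-(a * t)) ≤ w t := by
  have hd : ∀ m : ℕ, m < 4 → ∀ x, HasDerivAt (iteratedDeriv m w) (iteratedDeriv (m + 1) w x) x := by
    intro m hm x
    rw [iteratedDeriv_succ]
    exact ((hw.contDiff.differentiable_iteratedDeriv m (by exact_mod_cast hm)) x).hasDerivAt
  have hd0 : ∀ x, HasDerivAt w (iteratedDeriv 1 w x) x := by
    simpa using hd 0 (by norm_num)
  -- By the equation, `f = a² w - w''` has `f'' - b² f = -w ^ q < 0`.
  have hpos : ∀ x, 0 < a ^ 2 * w x - iteratedDeriv 2 w x := by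
    refine pos_of_memLp (f := fun x => a ^ 2 * w x - iteratedDeriv 2 w x)
      (f' := fun x => a ^ 2 * iteratedDeriv 1 w x - iteratedDeriv 3 w x)
      (f'' := fun x => a ^ 2 * iteratedDeriv 2 w x - iteratedDeriv 4 w x) hb
      (fun x => ((hd0 x).const_mul _).sub (hd 2 (by norm_num) x))
      (fun x => ((hd 1 (by norm_num) x).const_mul _).sub (hd 3 (by norm_num) x))
      (fun x => ?_) ((hw.memLp_self.const_mul _).sub hw.memLp_deriv_two)
    have h1 := hw.ode x
    have h2 := Real.rpow_pos_of_pos (hw.pos x) q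
    linarith
  exact mul_exp_neg_le_of_memLp ha hd0 (hd 1 (by norm_num)) (fun x => sub_pos.1 (hpos x))
    hw.memLp_self ht

/-- Periodicity would bound `w` below by its minimum over one period, which is positive,
contradicting square integrability. -/
theorem IsPositiveEvenH2Solution.not_periodic {A B q : ℝ} {w : ℝ → ℝ}
    (hw : IsPositiveEvenH2Solution A B q w) {T : ℝ} (hT : T ≠ 0) : ¬ Function.Periodic w T := by
  intro hper
  have hper' : Function.Periodic w |T| := by
    rcases abs_choice T with h | h <;> rw [h]
    exacts [hper, hper.neg]
  have hcont : Continuous w := hw.contDiff.continuous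
  obtain ⟨x₀, -, hx₀⟩ := (isCompact_Icc (a := (0 : ℝ)) (b := |T|)).exists_isMinOn
    (Set.nonempty_Icc.2 (abs_nonneg T)) hcont.continuousOn
  refine not_memLp_two_of_eventually_le_abs (hw.pos x₀) (Eventually.of_forall fun t => ?_)
    hw.memLp_self
  obtain ⟨y, hy, hty⟩ := hper'.exists_mem_Ico₀ (abs_pos.2 hT) t
  rw [hty]
  exact (hx₀ (Set.Ico_subset_Icc_self hy)).trans (le_abs_self _)

/-- The smaller exponent of the characteristic polynomial lies below `(n - 4 - α) / 2`. -/
theorem exists_characteristic_factorization {n : ℕ} (hn : 5 ≤ n) {α lam mu : ℝ} (hα : α ≤ -2)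
    (hmu : 0 ≤ mu) (hlam : ((n : ℝ) - 2) * (2 + α) + 2 * Real.sqrt mu < lam)
    (hK₂ : 0 < K₂ n α lam) (hK₀ : 0 < K₀ n α lam mu) :
    ∃ a b : ℝ, 0 < a ∧ 0 < b ∧ a < ((n : ℝ) - 4 - α) / 2 ∧
      K₂ n α lam = a ^ 2 + b ^ 2 ∧ K₀ n α lam mu = a ^ 2 * b ^ 2 := by
  have hn' : (5 : ℝ) ≤ n := by exact_mod_cast hn
  set A := K₂ n α lam with hA
  set B := K₀ n α lam mu with hB
  set d := lam - ((n : ℝ) - 2) * (2 + α) with hd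
  have hmu' := Real.sq_sqrt hmu
  have hmu0 := Real.sqrt_nonneg mu
  -- The discriminant depends on `lam` only through `d`, so the hypothesis on `lam` makes the roots
  -- real.
  have hdisc : A ^ 2 - 4 * B = d ^ 2 - 4 * mu := by
    rw [hA, hB, hd, K₂, K₀]; ring
  have hdpos : 2 * Real.sqrt mu < d := by rw [hd]; linarith
  have hD : 0 ≤ A ^ 2 - 4 * B := by rw [hdisc]; nlinarith
  set r := Real.sqrt (A ^ 2 - 4 * B) with hr
  have hr2 : r ^ 2 = A ^ 2 - 4 * B := Real.sq_sqrt hD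
  have hr0 : 0 ≤ r := Real.sqrt_nonneg _
  have hrA : r < A := by nlinarith
  -- The smaller root is at most `A / 2`, while `γ² = (A + d) / 2` with `d > 0`.
  have hsq : (A - r) / 2 < (((n : ℝ) - 4 - α) / 2) ^ 2 := by
    have h : (((n : ℝ) - 4 - α) / 2) ^ 2 = A / 2 + d / 2 := by
      rw [hA, hd, K₂]; ring
    rw [h]; linarith
  refine ⟨Real.sqrt ((A - r) / 2), Real.sqrt ((A + r) / 2), Real.sqrt_pos.2 (by linarith),
    Real.sqrt_pos.2 (by linarith), ?_, ?_, ?_⟩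
  · rw [Real.sqrt_lt' (by linarith)]
    exact hsq
  · rw [Real.sq_sqrt (by linarith), Real.sq_sqrt (by linarith)]; ring
  · rw [Real.sq_sqrt (by linarith), Real.sq_sqrt (by linarith)]; linarith

theorem tendsto_radialProfile_atTop {n : ℕ} {α a c : ℝ} {v : ℝ → ℝ} (hc : 0 < c)
    (ha : a < ((n : ℝ) - 4 - α) / 2) (hv : ∀ t, 0 ≤ t → c * Real.exp (-(a * t)) ≤ v t) :
    Tendsto (radialProfile n α v) (𝓝[≠] (0 : EuclideanSpace ℝ (Fin n))) atTop := by
  have hlog : Tendsto (fun x : EuclideanSpace ℝ (Fin n) => -Real.log ‖x‖) (𝓝[≠] 0) atTop :=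
    tendsto_neg_atBot_atTop.comp (Real.tendsto_log_nhdsGT_zero.comp tendsto_norm_nhdsNE_zero)
  have hlow : Tendsto (fun x : EuclideanSpace ℝ (Fin n) =>
      c * Real.exp ((((n : ℝ) - 4 - α) / 2 - a) * -Real.log ‖x‖)) (𝓝[≠] 0) atTop :=
    (Real.tendsto_exp_atTop.comp (hlog.const_mul_atTop (sub_pos.2 ha))).const_mul_atTop hc
  -- The lower bound on `v` is available only for `-log ‖x‖ ≥ 0`, which holds near the origin.
  refine tendsto_atTop_mono' _ ?_ hlow
  filter_upwards [hlog.eventually_ge_atTop 0, self_mem_nhdsWithin] with x hx hx0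
  rw [radialProfile, Real.rpow_def_of_pos (norm_pos_iff.2 hx0)]
  refine le_trans (le_of_eq ?_) (mul_le_mul_of_nonneg_left (hv _ hx) (Real.exp_pos _).le)
  rw [mul_left_comm, ← Real.exp_add]
  ring_nf

/-- `NeZero n` makes the punctured neighbourhood filter nontrivial; for `n = 0` it is `⊥` and every
function is bounded along it. -/
theorem not_boundedNearZero_of_tendsto_atTop {n : ℕ} [NeZero n] {u : EuclideanSpace ℝ (Fin n) → ℝ}
    (hu : Tendsto u (𝓝[≠] 0) atTop) : ¬ BoundedNearZero u := by
  rintro ⟨C, hC⟩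
  obtain ⟨x, hx, hx'⟩ := (hC.and (hu.eventually_gt_atTop C)).exists
  exact absurd ((le_abs_self _).trans hx) hx'.not_ge

theorem not_extendsContinuouslyToZero_of_tendsto_atTop {n : ℕ} [NeZero n]
    {u : EuclideanSpace ℝ (Fin n) → ℝ} (hu : Tendsto u (𝓝[≠] 0) atTop) :
    ¬ ExtendsContinuouslyToZero u := by
  rintro ⟨w, hw, hwu⟩
  refine not_tendsto_nhds_of_tendsto_atTop hu (w 0) ?_
  refine (hw.tendsto.mono_left nhdsWithin_le_nhds).congr' ?_
  filter_upwards [self_mem_nhdsWithin] with x hx using hwu x hx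

end WeightedBiharmonic

theorem proposition2p4 (n : ℕ) (hn : 5 ≤ n) (α p lam mu : ℝ) (hp : 1 < p)
    (hα₁ : -(n : ℝ) < α) (hα₂ : α ≤ -2) (hmu : 0 ≤ mu)
    (hlam : ((n : ℝ) - 2) * (2 + α) + 2 * Real.sqrt mu < lam)
    (hK₂ : 0 < WeightedBiharmonic.K₂ n α lam) (hK₀ : 0 < WeightedBiharmonic.K₀ n α lam mu)
    (v : ℝ → ℝ)
    (hv : WeightedBiharmonic.IsPositiveEvenH2Solution
      (WeightedBiharmonic.K₂ n α lam) (WeightedBiharmonic.K₀ n α lam mu) p v) :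
    Tendsto (WeightedBiharmonic.radialProfile n α v)
        (𝓝[≠] (0 : EuclideanSpace ℝ (Fin n))) atTop ∧
      ¬ WeightedBiharmonic.BoundedNearZero (WeightedBiharmonic.radialProfile n α v) ∧
      ¬ WeightedBiharmonic.ExtendsContinuouslyToZero (WeightedBiharmonic.radialProfile n α v) ∧
      ¬ ∃ T : ℝ, T ≠ 0 ∧ Function.Periodic v T := by
  have : NeZero n := ⟨by omega⟩
  obtain ⟨a, b, ha, hb, hlt, h₂, h₀⟩ :=
    WeightedBiharmonic.exists_characteristic_factorization hn hα₂ hmu hlam hK₂ hK₀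
  have hlim := WeightedBiharmonic.tendsto_radialProfile_atTop (hv.pos 0) hlt
    fun t ht => WeightedBiharmonic.IsPositiveEvenH2Solution.mul_exp_neg_le ha hb (h₂ ▸ h₀ ▸ hv) ht
  exact ⟨hlim, WeightedBiharmonic.not_boundedNearZero_of_tendsto_atTop hlim,
    WeightedBiharmonic.not_extendsContinuouslyToZero_of_tendsto_atTop hlim,
    fun ⟨_, hT, hper⟩ => hv.not_periodic hT hper⟩
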